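/- Let $d\ge 1$ be an integer, $r\in[1,\infty)$ a real number and $p=rd$. Let $(X,\mathcal F,\mu)$ be a probability space and let $T_1,\dots,T_d:X\to X$ be (possibly different, not necessarily invertible or ergodic) measure-preserving transformations. Let $L_{p,\pi}(\mu^d)=L_p(\mu)\hat\otimes_\pi\cdots\hat\otimes_\pi L_p(\mu)$ be the $d$-fold projective tensor product of $L_p(\mu)$ (real or complex scalars), that is, the completion of the algebraic tensor product in the projective norm. Let $D_d:L_{p,\pi}(\mu^d)\to L_r(\mu)$ be the unique continuous linear map such that $D_d(f_1\otimes\cdots\otimes f_d)=f_1\cdots f_d$ (pointwise product) for all $f_1,\dots,f_d\in L_p(\mu)$. For $\mathbf k=(k_1,\dots,k_d)\in\mathbb Z_+^d$ put $V^{\mathbf k}=V_1^{k_1}\otimes_\pi\cdots\otimes_\pi V_d^{k_d}$ on $L_{p,\pi}(\mu^d)$, where $V_lg=g\circ T_l$; thus $V^{\mathbf k}$ is composition of a kernel with $(x_1,\dots,x_d)\mapsto(T_1^{k_1}x_1,\dots,T_d^{k_d}x_d)$. For $l=1,\dots,d$ let $E_{\mathrm{inv},l}$ be the conditional expectation operator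 on $L_p(\mu)$ with respect to the $\sigma$-field of all $A\in\mathcal F$ with $T_l^{-1}A=A$. Then for every $f\in L_{p,\pi}(\mu^d)$, \[ \frac{1}{n_1\cdots n_d}\sum_{\mathbf 0\le\mathbf k<\mathbf n}D_dV^{\mathbf k}f\;\longrightarrow\; D_d\,(E_{\mathrm{inv},1}\otimes_\pi\cdots\otimes_\pi E_{\mathrm{inv},d})\,f \qquad\text{as } n_1,\dots,n_d\to\infty \] $\mu$-almost surely and in the norm of $L_r(\mu)$. Here $\mathbf n=(n_1,\dots,n_d)$, the sum is over all $\mathbf k$ with $0\le k_l<n_l$ for every $l$, and $n_1,\dots,n_d\to\infty$ means that $\min_l n_l\to\infty$, with no relation between the $n_l$. -/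

import Mathlib

open MeasureTheory Filter Topology
open scoped ENNReal TensorProduct

noncomputable section

namespace VStat

/-! ### The projective tensor power of `L_p(μ)` -/

section ProjectiveTensor

variable (𝕜 : Type*) [RCLike 𝕜] {X : Type*} [MeasurableSpace X]

/-- `L_{p,π}(μ^d)`: the `d`-fold projective tensor power of `L_p(μ)`, that is, the completion
of the algebraic tensor product `L_p(μ) ⊗ ⋯ ⊗ L_p(μ)` for the projective tensor norm (which is
the norm that Mathlib puts on `⨂[𝕜] i, E i`). -/
abbrev LpPi (d : ℕ) (p : ℝ≥0∞) [Fact (1 ≤ p)] (μ : Measure X) : Type _ :=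
  UniformSpace.Completion (⨂[𝕜] _ : Fin d, Lp 𝕜 p μ)

variable {𝕜} {d : ℕ} {p : ℝ≥0∞} [Fact (1 ≤ p)] {μ : Measure X}

/-- The bounded linear map on `L_{p,π}(μ^d)` induced by a bounded `d`-linear map `Φ` on
`L_p(μ) × ⋯ × L_p(μ)` with values in a Banach space: the unique continuous linear map that
sends every elementary tensor `f₁ ⊗ ⋯ ⊗ f_d` to `Φ (f₁, …, f_d)`. -/
def LpPi.lift {F : Type*} [NormedAddCommGroup F] [NormedSpace 𝕜 F] [CompleteSpace F]
    (Φ : ContinuousMultilinearMap 𝕜 (fun _ : Fin d => Lp 𝕜 p μ) F) :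
    LpPi 𝕜 d p μ →L[𝕜] F :=
  (PiTensorProduct.liftIsometry 𝕜 (fun _ : Fin d => Lp 𝕜 p μ) F Φ).extend
    (UniformSpace.Completion.toComplL : _ →L[𝕜] LpPi 𝕜 d p μ)

/-- The elementary tensor `f₁ ⊗ ⋯ ⊗ f_d` in `L_{p,π}(μ^d)`, as a bounded `d`-linear map. -/
def LpPi.tprod : ContinuousMultilinearMap 𝕜 (fun _ : Fin d => Lp 𝕜 p μ) (LpPi 𝕜 d p μ) :=
  (UniformSpace.Completion.toComplL : _ →L[𝕜] LpPi 𝕜 d p μ).compContinuousMultilinearMap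
    (PiTensorProduct.tprodL 𝕜)

/-- The projective tensor product `A₁ ⊗_π ⋯ ⊗_π A_d` of bounded operators on `L_p(μ)`. -/
def LpPi.map (A : Fin d → (Lp 𝕜 p μ →L[𝕜] Lp 𝕜 p μ)) : LpPi 𝕜 d p μ →L[𝕜] LpPi 𝕜 d p μ :=
  LpPi.lift (LpPi.tprod.compContinuousLinearMap A)

end ProjectiveTensor

/-! ### Restriction to the diagonal -/

section Diagonal

variable {𝕜 : Type*} [RCLike 𝕜] {X : Type*} [MeasurableSpace X] {μ : Measure X}

/-- The multiple Hölder inequality. -/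
theorem eLpNorm_prod_le [IsProbabilityMeasure μ] {ι : Type*} (s : Finset ι) {q : ι → ℝ≥0∞}
    {f : ι → X → 𝕜} (hf : ∀ i ∈ s, AEStronglyMeasurable (f i) μ) :
    eLpNorm (∏ i ∈ s, f i) (∑ i ∈ s, (q i)⁻¹)⁻¹ μ ≤ ∏ i ∈ s, eLpNorm (f i) (q i) μ := by
  induction s using Finset.cons_induction with
  | empty =>
    simp [eLpNormEssSup_const, Pi.one_def, IsProbabilityMeasure.ne_zero]
  | cons i s hi ih =>
    rw [Finset.prod_cons, Finset.prod_cons]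
    have hs : ∀ j ∈ s, AEStronglyMeasurable (f j) μ := fun j hj =>
      hf j (Finset.mem_cons_of_mem hj)
    have key := eLpNorm_smul_le_mul_eLpNorm (p := q i) (q := (∑ i ∈ s, (q i)⁻¹)⁻¹)
      (r := (∑ j ∈ Finset.cons i s hi, (q j)⁻¹)⁻¹)
      (Finset.aestronglyMeasurable_prod s hs) (hf i (Finset.mem_cons_self i s))
      (hpqr := ⟨by simp⟩)
    exact key.trans (mul_le_mul_right (ih hs) _)

variable {d : ℕ} {p r : ℝ≥0∞} [Fact (1 ≤ p)] [Fact (1 ≤ r)]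

theorem exponent_eq (hr : r ≠ ∞) (hpr : p = r * d) :
    (∑ _i : Fin d, p⁻¹)⁻¹ = r := by
  have hp : (1 : ℝ≥0∞) ≤ p := Fact.out
  have hd : d ≠ 0 := by
    rintro rfl
    simp [hpr] at hp
  have hr0 : r ≠ 0 := (zero_lt_one.trans_le (Fact.out : (1 : ℝ≥0∞) ≤ r)).ne'
  have hd0 : (d : ℝ≥0∞) ≠ 0 := by exact_mod_cast hd
  rw [Finset.sum_const, Finset.card_univ, Fintype.card_fin, nsmul_eq_mul, hpr,
    ENNReal.mul_inv (Or.inl hr0) (Or.inl hr), mul_comm, mul_assoc,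
    ENNReal.inv_mul_cancel hd0 (ENNReal.natCast_ne_top d), mul_one, inv_inv]

theorem memLp_prod (hr : r ≠ ∞) (hpr : p = r * d) (f : Fin d → Lp 𝕜 p μ) :
    MemLp (fun x => ∏ i, f i x) r μ := by
  have h := MemLp.prod' (s := Finset.univ) (fun i (_ : i ∈ Finset.univ) => Lp.memLp (f i))
  rwa [exponent_eq hr hpr] at h

variable (μ) in
/-- The `d`-linear map `(f₁, …, f_d) ↦ (x ↦ f₁ x ⋯ f_d x)` from `L_p(μ) × ⋯ × L_p(μ)` to
`L_r(μ)`, where `p = r d`. -/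
def mulMultilinear [IsProbabilityMeasure μ] (hr : r ≠ ∞) (hpr : p = r * d) :
    ContinuousMultilinearMap 𝕜 (fun _ : Fin d => Lp 𝕜 p μ) (Lp 𝕜 r μ) :=
  MultilinearMap.mkContinuous
    { toFun := fun f => (memLp_prod hr hpr f).toLp (fun x => ∏ i, f i x)
      map_update_add' := by
        intro _ f i a b
        rw [← MemLp.toLp_add]
        refine MemLp.toLp_congr _ _ ?_
        filter_upwards [Lp.coeFn_add a b] with x hx
        have e : ∀ c : Lp 𝕜 p μ, ∏ j, (Function.update f i c j : X → 𝕜) x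
            = (c : X → 𝕜) x * ∏ j ∈ Finset.univ.erase i, (f j : X → 𝕜) x := by
          intro c
          rw [← Finset.mul_prod_erase _ _ (Finset.mem_univ i), Function.update_self]
          congr 1
          refine Finset.prod_congr rfl fun j hj => ?_
          rw [Function.update_of_ne (Finset.ne_of_mem_erase hj)]
        simp only [Pi.add_apply] at hx ⊢
        rw [e, e, e, hx, add_mul]
      map_update_smul' := by
        intro _ f i c a
        rw [← MemLp.toLp_const_smul]
        refine MemLp.toLp_congr _ _ ?_
        filter_upwards [Lp.coeFn_smul c a] with x hx
        have e : ∀ c : Lp 𝕜 p μ, ∏ j, (Function.update f i c j : X → 𝕜) x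
            = (c : X → 𝕜) x * ∏ j ∈ Finset.univ.erase i, (f j : X → 𝕜) x := by
          intro c
          rw [← Finset.mul_prod_erase _ _ (Finset.mem_univ i), Function.update_self]
          congr 1
          refine Finset.prod_congr rfl fun j hj => ?_
          rw [Function.update_of_ne (Finset.ne_of_mem_erase hj)]
        simp only [Pi.smul_apply] at hx ⊢
        rw [e, e, hx, smul_mul_assoc] }
    1 (by
      intro f
      change ‖(memLp_prod hr hpr f).toLp (fun x => ∏ i, f i x)‖ ≤ _
      rw [one_mul, Lp.norm_toLp]
      simp only [Lp.norm_def]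
      rw [← ENNReal.toReal_prod]
      refine ENNReal.toReal_mono (ENNReal.prod_ne_top fun i _ => Lp.eLpNorm_ne_top (f i)) ?_
      have h := eLpNorm_prod_le (μ := μ) (Finset.univ : Finset (Fin d)) (q := fun _ => p)
        (f := fun i => (f i : X → 𝕜)) fun i _ => Lp.aestronglyMeasurable (f i)
      rwa [exponent_eq hr hpr, Finset.prod_fn] at h)

variable (μ) in
/-- The restriction operator `D_d : L_{p,π}(μ^d) → L_r(μ)`, `p = r d`: the continuous linear map
with `D_d (f₁ ⊗ ⋯ ⊗ f_d) = f₁ ⋯ f_d`. -/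
def diag [IsProbabilityMeasure μ] (hr : r ≠ ∞) (hpr : p = r * d) :
    LpPi 𝕜 d p μ →L[𝕜] Lp 𝕜 r μ :=
  LpPi.lift (mulMultilinear μ hr hpr)

end Diagonal

/-! ### The dynamics and the invariant conditional expectations -/

section Dynamics

variable (𝕜 : Type*) [RCLike 𝕜] {X : Type*} [MeasurableSpace X] {μ : Measure X}
variable (p : ℝ≥0∞) [Fact (1 ≤ p)]

/-- The operator `V f = f ∘ T` on `L_p(μ)`. -/
def koopman {T : X → X} (hT : MeasurePreserving T μ μ) : Lp 𝕜 p μ →L[𝕜] Lp 𝕜 p μ :=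
  (Lp.compMeasurePreservingₗᵢ 𝕜 T hT).toContinuousLinearMap

/-- The operator `V^k = V₁^{k₁} ⊗_π ⋯ ⊗_π V_d^{k_d}` on `L_{p,π}(μ^d)`, i.e. the composition of
the kernel with `(x₁, …, x_d) ↦ (T₁^{k₁} x₁, …, T_d^{k_d} x_d)`. -/
def koopmanPi {d : ℕ} {T : Fin d → X → X} (hT : ∀ i, MeasurePreserving (T i) μ μ)
    (k : Fin d → ℕ) : LpPi 𝕜 d p μ →L[𝕜] LpPi 𝕜 d p μ :=
  LpPi.map fun i => koopman 𝕜 p (hT i) ^ k i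

variable (μ) in
/-- The conditional expectation `f ↦ E(f | m)` as a bounded operator on `L_p(μ)`. -/
def condExpLp [IsProbabilityMeasure μ] (m : MeasurableSpace X) : Lp 𝕜 p μ →L[𝕜] Lp 𝕜 p μ :=
  LinearMap.mkContinuous
    { toFun := fun f => ((Lp.memLp f).condExp (m := m) Fact.out).toLp (μ[f | m])
      map_add' := by
        intro f g
        rw [← MemLp.toLp_add]
        refine MemLp.toLp_congr _ _ ?_
        exact (condExp_congr_ae (Lp.coeFn_add f g)).trans
          (condExp_add ((Lp.memLp f).integrable Fact.out) ((Lp.memLp g).integrable Fact.out) m)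
      map_smul' := by
        intro c f
        rw [RingHom.id_apply, ← MemLp.toLp_const_smul]
        refine MemLp.toLp_congr _ _ ?_
        exact (condExp_congr_ae (Lp.coeFn_smul c f)).trans (condExp_smul c f m) }
    1 (by
      intro f
      change ‖((Lp.memLp f).condExp (m := m) Fact.out).toLp (μ[f | m])‖ ≤ _
      rw [one_mul, Lp.norm_toLp, Lp.norm_def]
      exact ENNReal.toReal_mono (Lp.eLpNorm_ne_top f) (eLpNorm_condExp_le_eLpNorm _ Fact.out))

variable (μ) in
/-- `E_inv`: the conditional expectation with respect to the σ-algebra of the measurable sets `A`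
with `T⁻¹ A = A`, as an operator on `L_p(μ)`. -/
def condExpInv [IsProbabilityMeasure μ] (T : X → X) : Lp 𝕜 p μ →L[𝕜] Lp 𝕜 p μ :=
  condExpLp 𝕜 μ p (MeasurableSpace.invariants T)

variable {𝕜 p}

/-- The average `(n₁ ⋯ n_d)⁻¹ ∑_{0 ≤ k < n} D_d V^k f` in `L_r(μ)`, the sum being over all
`k = (k₁, …, k_d)` with `0 ≤ k_i < n_i` for every `i`. -/
def ergodicAverage [IsProbabilityMeasure μ] {d : ℕ} {r : ℝ≥0∞} [Fact (1 ≤ r)] (hr : r ≠ ∞)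
    (hpr : p = r * d) {T : Fin d → X → X} (hT : ∀ i, MeasurePreserving (T i) μ μ)
    (f : LpPi 𝕜 d p μ) (n : Fin d → ℕ) : Lp 𝕜 r μ :=
  (∏ i, (n i : 𝕜))⁻¹ • ∑ k ∈ Fintype.piFinset fun i => Finset.range (n i),
    diag μ hr hpr (koopmanPi 𝕜 p hT k f)

end Dynamics

end VStat

end

/-! Write `f = ∑ c_j u_{j1} ⊗ ⋯ ⊗ u_{jd}` with `∑ |c_j| < ∞` and `‖u_{ji}‖_p ≤ 1`
(`exists_representation`). On an elementary tensor the average over a box factors into a pointwise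
product of `d` one-parameter Birkhoff averages (`ergodicAverage_tprod`). Each factor converges
almost surely by Birkhoff's theorem and in `L_p` by the mean ergodic theorem, so only the
interchange of limit and series remains.

In norm, the `j`-th term is at most `|c_j|` for every `n`, and dominated convergence for series
applies (`tendsto_ergodicAverage`).

Almost surely, the tails must be small for all large `n` at once. From `∏ a_i ≤ ∑ a_i ^ d` and
convexity of `t ↦ t ^ d`, the tail outside a finite set `s` is at most the sum over `i` of the
Birkhoff averages, of length `n_i`, of `G_{s,i} = ∑_{j ∉ s} |c_j| |u_{ji}| ^ d`
(`norm_sum_smul_prod_birkhoffAverage_le`). This function is integrable because `d ≤ p`. Each summand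
involves a single `n_i`, so Birkhoff's theorem handles the bound with no relation between the `n_i`
and no multiparameter maximal inequality. Its limit, the sum of the invariant conditional
expectations of the `G_{s,i}`, has integral at most `d ∑_{j ∉ s} |c_j|`; hence at almost every point
it is below any `ε` for a suitable `s`. -/

noncomputable section

namespace VStat

/-! ### The maximal ergodic inequality and Birkhoff's theorem. -/

section Birkhoff

variable {X : Type*}

/-- The running maximum `max (S_0 h, …, S_N h)` of the Birkhoff sums. -/
def birkhoffMax (T : X → X) (h : X → ℝ) : ℕ → X → ℝ
  | 0 => 0
  | N + 1 => fun x => max (birkhoffMax T h N x) (birkhoffSum T h (N + 1) x)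

theorem birkhoffSum_le_birkhoffMax (T : X → X) (h : X → ℝ) (N : ℕ) (x : X) :
    ∀ n ≤ N, birkhoffSum T h n x ≤ birkhoffMax T h N x := by
  induction N with
  | zero =>
    intro n hn
    obtain rfl : n = 0 := by omega
    simp [birkhoffMax]
  | succ N ih =>
    intro n hn
    rcases Nat.lt_or_ge N n with h1 | h1
    · obtain rfl : n = N + 1 := by omega
      exact le_max_right _ _
    · exact (ih n h1).trans (le_max_left _ _)

theorem birkhoffMax_nonneg (T : X → X) (h : X → ℝ) (N : ℕ) (x : X) : 0 ≤ birkhoffMax T h N x := by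
  simpa using birkhoffSum_le_birkhoffMax T h N x 0 (Nat.zero_le _)

theorem exists_birkhoffMax_eq (T : X → X) (h : X → ℝ) (N : ℕ) (x : X) :
    ∃ n ≤ N, birkhoffMax T h N x = birkhoffSum T h n x := by
  induction N with
  | zero => exact ⟨0, le_rfl, by simp [birkhoffMax]⟩
  | succ N ih =>
    obtain ⟨n, hn, e⟩ := ih
    rcases max_choice (birkhoffMax T h N x) (birkhoffSum T h (N + 1) x) with h1 | h1
    · exact ⟨n, by omega, by rw [← e]; exact h1⟩
    · exact ⟨N + 1, le_rfl, h1⟩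

/-- A positive maximum is attained at some `n + 1`, and the sum of length `n + 1` at `x` is `h x`
plus the sum of length `n` at `T x`. -/
theorem birkhoffMax_sub_comp_le (T : X → X) (h : X → ℝ) (N : ℕ) (x : X)
    (hx : 0 < birkhoffMax T h N x) : birkhoffMax T h N x - birkhoffMax T h N (T x) ≤ h x := by
  obtain ⟨n, hn, e⟩ := exists_birkhoffMax_eq T h N x
  cases n with
  | zero => simp [e] at hx
  | succ n =>
    have := birkhoffSum_le_birkhoffMax T h N (T x) n (by omega)
    rw [e, birkhoffSum_succ']
    linarith

variable [MeasurableSpace X]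

theorem measurable_birkhoffSum {M : Type*} [AddCommMonoid M] [MeasurableSpace M]
    [MeasurableAdd₂ M] {T : X → X} {h : X → M} (hT : Measurable T) (hh : Measurable h) (n : ℕ) :
    Measurable (birkhoffSum T h n) :=
  Finset.measurable_fun_sum _ fun k _ => hh.comp (hT.iterate k)

theorem integrable_birkhoffSum {E : Type*} [NormedAddCommGroup E] {μ : Measure X} {T : X → X}
    {h : X → E} (hT : MeasurePreserving T μ μ) (hh : Integrable h μ) (n : ℕ) :
    Integrable (birkhoffSum T h n) μ :=
  integrable_finsetSum _ fun k _ => ((hT.iterate k).integrable_comp hh.aestronglyMeasurable).2 hh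

theorem measurable_birkhoffMax {T : X → X} {h : X → ℝ} (hT : Measurable T) (hh : Measurable h)
    (N : ℕ) : Measurable (birkhoffMax T h N) := by
  induction N with
  | zero => exact measurable_const
  | succ N ih => exact ih.max (measurable_birkhoffSum hT hh _)

theorem integrable_birkhoffMax {μ : Measure X} {T : X → X} {h : X → ℝ}
    (hT : MeasurePreserving T μ μ) (hh : Integrable h μ) (N : ℕ) :
    Integrable (birkhoffMax T h N) μ := by
  induction N with
  | zero => exact integrable_zero _ _ _
  | succ N ih => exact ih.sup (integrable_birkhoffSum hT hh _)

/-- The maximal ergodic inequality, when the Birkhoff sums are almost surely not all `≤ 0`. -/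
theorem integral_nonneg_of_exists_birkhoffSum_pos {μ : Measure X} {T : X → X} {h : X → ℝ}
    (hT : MeasurePreserving T μ μ) (hm : Measurable h) (hh : Integrable h μ)
    (hpos : ∀ᵐ x ∂μ, ∃ n, 0 < birkhoffSum T h n x) : 0 ≤ ∫ x, h x ∂μ := by
  set A : ℕ → Set X := fun N => {x | 0 < birkhoffMax T h N x} with hA
  have hAm : ∀ N, MeasurableSet (A N) := fun N =>
    measurableSet_lt measurable_const (measurable_birkhoffMax hT.measurable hm N)
  have hN : ∀ N, 0 ≤ ∫ x, (A N).indicator h x ∂μ := by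
    intro N
    have hi := integrable_birkhoffMax hT hh N
    have hi' : Integrable (fun x => birkhoffMax T h N (T x)) μ :=
      (hT.integrable_comp hi.aestronglyMeasurable).2 hi
    have e : ∫ x, birkhoffMax T h N (T x) ∂μ = ∫ x, birkhoffMax T h N x ∂μ := by
      rw [← integral_map hT.measurable.aemeasurable
        (by rw [hT.map_eq]; exact hi.aestronglyMeasurable), hT.map_eq]
    calc (0 : ℝ) = ∫ x, (birkhoffMax T h N x - birkhoffMax T h N (T x)) ∂μ := by
          rw [integral_sub hi hi', e, sub_self]
      _ ≤ _ := by
          -- Off `A N` the maximum at `x` vanishes and the one at `T x` is nonnegative, so the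
          -- difference is at most `0`.
          refine integral_mono (hi.sub hi') (hh.indicator (hAm N)) fun x => ?_
          by_cases hx : x ∈ A N
          · simpa [hx] using birkhoffMax_sub_comp_le T h N x hx
          · simp only [hx, not_false_eq_true, Set.indicator_of_notMem]
            have h1 : birkhoffMax T h N x ≤ 0 := not_lt.1 hx
            linarith [birkhoffMax_nonneg T h N (T x)]
  have hlim : Tendsto (fun N => ∫ x, (A N).indicator h x ∂μ) atTop (𝓝 (∫ x, h x ∂μ)) := by
    refine tendsto_integral_of_dominated_convergence (fun x => ‖h x‖)
      (fun N => (hh.indicator (hAm N)).aestronglyMeasurable) hh.norm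
      (fun N => ae_of_all _ fun x => norm_indicator_le_norm_self _ _) ?_
    filter_upwards [hpos] with x ⟨n, hn⟩
    refine tendsto_const_nhds.congr' ?_
    filter_upwards [eventually_ge_atTop n] with N hnN
    have : x ∈ A N := hn.trans_le (birkhoffSum_le_birkhoffMax T h N x n hnN)
    simp [this]
  exact ge_of_tendsto' hlim hN

/-- Let `h = f - E(f | inv) - ε/2` and let `B` be the set where the Birkhoff sums of `h` are
unbounded above. `B` is invariant, so the maximal inequality on `B` gives `0 ≤ ∫_B h = -(ε/2) μ(B)`,
and `B` is null. Off `B` the sums are bounded by some `K`, and the other half of `ε` absorbs `K /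
n`. -/
theorem eventually_birkhoffAverage_le {μ : Measure X} [IsProbabilityMeasure μ] {T : X → X}
    {f : X → ℝ} (hT : MeasurePreserving T μ μ) (hm : Measurable f) (hf : Integrable f μ)
    {ε : ℝ} (hε : 0 < ε) :
    ∀ᵐ x ∂μ, ∀ᶠ n in atTop,
      birkhoffAverage ℝ T f n x ≤ (μ[f | MeasurableSpace.invariants T]) x + ε := by
  set φ : X → ℝ := μ[f | MeasurableSpace.invariants T] with hφ
  have hle := MeasurableSpace.invariants_le T
  have hφm' : Measurable[MeasurableSpace.invariants T] φ := stronglyMeasurable_condExp.measurable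
  have hφm : Measurable φ := hφm'.mono hle le_rfl
  have hφT : φ ∘ T = φ := MeasurableSpace.comp_eq_of_measurable_invariants hφm'
  set h : X → ℝ := fun x => f x - φ x - ε / 2 with hh
  have hhm : Measurable h := (hm.sub hφm).sub_const _
  have hhi : Integrable h μ := (hf.sub integrable_condExp).sub (integrable_const _)
  set B : Set X := {x | ∀ K : ℕ, ∃ n, (K : ℝ) < birkhoffSum T h n x} with hB
  have hBm : MeasurableSet B := by
    simp only [hB, Set.ofPred_forall, Set.ofPred_exists]
    exact MeasurableSet.iInter fun K => MeasurableSet.iUnion fun n =>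
      measurableSet_lt measurable_const (measurable_birkhoffSum hT.measurable hhm n)
  have hBT : T ⁻¹' B = B := by
    ext x
    simp only [Set.mem_preimage, hB, Set.mem_ofPred_eq]
    constructor
    · intro H K
      obtain ⟨K', hK'⟩ := exists_nat_gt ((K : ℝ) - h x)
      obtain ⟨n, hn⟩ := H K'
      exact ⟨n + 1, by rw [birkhoffSum_succ']; linarith⟩
    -- Passing to `T x` removes one term, so the index must be a successor; the empty sum exceeds no
    -- natural threshold.
    · intro H K
      obtain ⟨K', hK'⟩ := exists_nat_gt ((K : ℝ) + h x)
      obtain ⟨n, hn⟩ := H K'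
      cases n with
      | zero =>
        obtain ⟨K'', hK''⟩ := exists_nat_gt (max ((K : ℝ) + h x) 0)
        obtain ⟨n, hn⟩ := H K''
        cases n with
        | zero =>
          simp only [birkhoffSum_zero] at hn
          exact absurd hn (not_lt.2 (Nat.cast_nonneg _))
        | succ n =>
          refine ⟨n, ?_⟩
          rw [birkhoffSum_succ'] at hn
          have := le_max_left ((K : ℝ) + h x) 0
          linarith
      | succ n =>
        refine ⟨n, ?_⟩
        rw [birkhoffSum_succ'] at hn
        linarith
  have hTB : MeasurePreserving T (μ.restrict B) (μ.restrict B) := by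
    have := hT.restrict_preimage hBm
    rwa [hBT] at this
  have h1 : 0 ≤ ∫ x in B, h x ∂μ := by
    refine integral_nonneg_of_exists_birkhoffSum_pos hTB hhm hhi.integrableOn ?_
    filter_upwards [ae_restrict_mem hBm] with x hx
    simpa using hx 0
  have h2 : ∫ x in B, h x ∂μ = -(ε / 2) * μ.real B := by
    -- `B` belongs to the invariant σ-algebra, so `f` and its conditional expectation have the same
    -- integral over it.
    have e : ∫ x in B, φ x ∂μ = ∫ x in B, f x ∂μ := setIntegral_condExp hle hf ⟨hBm, hBT⟩
    simp only [hh]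
    have hφi : IntegrableOn φ B μ := integrable_condExp.integrableOn
    have hd : IntegrableOn (fun x => f x - φ x) B μ := hf.integrableOn.sub hφi
    rw [integral_sub hd (integrable_const _), integral_sub hf.integrableOn hφi, e]
    simp [mul_comm]
  have h3 : μ B = 0 := by
    have : μ.real B ≤ 0 := by
      rw [h2] at h1
      by_contra hc
      push Not at hc
      nlinarith
    have h0 : μ.real B = 0 := le_antisymm this measureReal_nonneg
    simpa [Measure.real, ENNReal.toReal_eq_zero_iff] using h0
  filter_upwards [measure_eq_zero_iff_ae_notMem.1 h3] with x hx
  simp only [hB, Set.mem_ofPred_eq, not_forall, not_exists, not_lt] at hx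
  obtain ⟨K, hK⟩ := hx
  obtain ⟨N, hN⟩ := exists_nat_gt ((K : ℝ) / (ε / 2))
  filter_upwards [eventually_ge_atTop (N + 1)] with n hn
  have hn0 : (0 : ℝ) < n := by exact_mod_cast (by omega : 0 < n)
  have hsum : birkhoffSum T h n x = birkhoffSum T f n x - n * φ x - n * (ε / 2) := by
    have := congrFun (birkhoffSum_of_comp_eq hφT n) x
    simp only [Pi.smul_apply, nsmul_eq_mul] at this
    rw [← this]
    simp [birkhoffSum, hh, Finset.sum_sub_distrib]
  have hKn : (K : ℝ) ≤ n * (ε / 2) := by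
    have : (N : ℝ) ≤ n := by exact_mod_cast (by omega : N ≤ n)
    exact ((div_lt_iff₀ (by positivity)).1 (hN.trans_le this)).le
  have := hK n
  rw [hsum] at this
  rw [birkhoffAverage, smul_eq_mul, inv_mul_le_iff₀ hn0]
  linarith

/-- The one-sided bound for `f` and for `-f`, along the countably many errors `1 / (m + 1)`. -/
theorem tendsto_birkhoffAverage_real {μ : Measure X} [IsProbabilityMeasure μ] {T : X → X}
    {f : X → ℝ} (hT : MeasurePreserving T μ μ) (hm : Measurable f) (hf : Integrable f μ) :
    ∀ᵐ x ∂μ, Tendsto (fun n => birkhoffAverage ℝ T f n x) atTop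
      (𝓝 ((μ[f | MeasurableSpace.invariants T]) x)) := by
  have hup : ∀ᵐ x ∂μ, ∀ m : ℕ, ∀ᶠ n in atTop, birkhoffAverage ℝ T f n x ≤
      (μ[f | MeasurableSpace.invariants T]) x + 1 / ((m : ℝ) + 1) :=
    ae_all_iff.2 fun m => eventually_birkhoffAverage_le hT hm hf (by positivity)
  have hlo : ∀ᵐ x ∂μ, ∀ m : ℕ, ∀ᶠ n in atTop, birkhoffAverage ℝ T (-f) n x ≤
      (μ[-f | MeasurableSpace.invariants T]) x + 1 / ((m : ℝ) + 1) :=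
    ae_all_iff.2 fun m => eventually_birkhoffAverage_le hT hm.neg hf.neg (by positivity)
  filter_upwards [hup, hlo, condExp_neg f (MeasurableSpace.invariants T) (μ := μ)]
    with x h1 h2 h3
  rw [Metric.tendsto_atTop']
  intro ε hε
  obtain ⟨m, hm⟩ := exists_nat_one_div_lt hε
  have := (h1 m).and (h2 m)
  obtain ⟨N, hN⟩ := eventually_atTop.1 this
  refine ⟨N, fun n hn => ?_⟩
  obtain ⟨h4, h5⟩ := hN n hn.le
  rw [h3, birkhoffAverage_neg] at h5
  simp only [Pi.neg_apply] at h5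
  rw [Real.dist_eq, abs_lt]
  constructor <;> linarith

/-- Birkhoff's pointwise ergodic theorem. -/
theorem tendsto_birkhoffAverage {𝕜 : Type*} [RCLike 𝕜] {μ : Measure X} [IsProbabilityMeasure μ]
    {T : X → X} {f : X → 𝕜} (hT : MeasurePreserving T μ μ) (hm : Measurable f)
    (hf : Integrable f μ) :
    ∀ᵐ x ∂μ, Tendsto (fun n => birkhoffAverage 𝕜 T f n x) atTop
      (𝓝 ((μ[f | MeasurableSpace.invariants T]) x)) := by
  filter_upwards [tendsto_birkhoffAverage_real hT (RCLike.measurable_re.comp hm) hf.re,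
    tendsto_birkhoffAverage_real hT (RCLike.measurable_im.comp hm) hf.im,
    RCLike.reCLM.comp_condExp_comm (m := MeasurableSpace.invariants T) hf,
    RCLike.imCLM.comp_condExp_comm (m := MeasurableSpace.invariants T) hf] with x h1 h2 h3 h4
  simp only [Function.comp_def, RCLike.reCLM_apply, RCLike.imCLM_apply] at h1 h2 h3 h4
  rw [← h3] at h1
  rw [← h4] at h2
  have e1 : ∀ n, birkhoffAverage ℝ T (fun x => RCLike.re (f x)) n x
      = RCLike.re (birkhoffAverage 𝕜 T f n x) := fun n =>
    (map_birkhoffAverage 𝕜 ℝ (RCLike.re : 𝕜 →+ ℝ) T f n x).symm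
  have e2 : ∀ n, birkhoffAverage ℝ T (fun x => RCLike.im (f x)) n x
      = RCLike.im (birkhoffAverage 𝕜 T f n x) := fun n =>
    (map_birkhoffAverage 𝕜 ℝ (RCLike.im : 𝕜 →+ ℝ) T f n x).symm
  simp only [e1] at h1
  simp only [e2] at h2
  have h5 := ((RCLike.continuous_ofReal (K := 𝕜)).tendsto _).comp h1
  have h6 := (((RCLike.continuous_ofReal (K := 𝕜)).tendsto _).comp h2).mul_const RCLike.I
  have := h5.add h6
  simpa only [Function.comp_def, RCLike.re_add_im] using this

end Birkhoff

/-! ### Series representation in the projective tensor power. -/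

section Representation

/-- The projective norm is an infimum over finite representations; one of cost below `b` is
normalised by moving the norms of the factors into the coefficient. A zero factor stays zero, since
`0⁻¹ = 0`. -/
theorem exists_finite_representation {κ : Type*} [Fintype κ] {𝕜 : Type*} [RCLike 𝕜]
    {E : κ → Type*} [∀ i, NormedAddCommGroup (E i)] [∀ i, NormedSpace 𝕜 (E i)]
    (x : ⨂[𝕜] i, E i) {b : ℝ} (hb : ‖x‖ < b) :
    ∃ (N : ℕ) (c : Fin N → 𝕜) (u : Fin N → ∀ i, E i), (∀ j i, ‖u j i‖ ≤ 1) ∧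
      ∑ j, ‖c j‖ < b ∧ ∑ j, c j • PiTensorProduct.tprod 𝕜 (u j) = x := by
  rw [PiTensorProduct.norm_def] at hb
  obtain ⟨⟨q, hq⟩, hqb⟩ := exists_lt_of_ciInf_lt hb
  rw [PiTensorProduct.mem_lifts_iff] at hq
  set l := q.toList with hl
  refine ⟨l.length, fun j => (l.get j).1 * ∏ i, (‖(l.get j).2 i‖ : 𝕜),
    fun j i => ((‖(l.get j).2 i‖⁻¹ : ℝ) : 𝕜) • (l.get j).2 i, ?_, ?_, ?_⟩
  · intro j i
    rw [norm_smul, RCLike.norm_ofReal, abs_inv, abs_norm]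
    exact inv_mul_le_one
  · refine lt_of_eq_of_lt ?_ hqb
    simp only [PiTensorProduct.projectiveSeminormAux]
    rw [← hl, ← Fin.sum_univ_fun_getElem]
    simp
  · rw [← hq, ← Fin.sum_univ_fun_getElem]
    refine Finset.sum_congr rfl fun j _ => ?_
    rw [mul_smul, ← MultilinearMap.map_smul_univ]
    congr 3
    funext i
    change _ = (l.get j).2 i
    rw [smul_smul, ← RCLike.ofReal_mul]
    rcases eq_or_ne ‖(l.get j).2 i‖ 0 with h | h
    · rw [norm_eq_zero.1 h, smul_zero]
    · rw [mul_inv_cancel₀ h, RCLike.ofReal_one, one_smul]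

variable {𝕜 : Type*} [RCLike 𝕜] {X : Type*} [MeasurableSpace X]
  {d : ℕ} {p : ℝ≥0∞} [Fact (1 ≤ p)] {μ : Measure X}

theorem LpPi.norm_tprod_le (u : Fin d → Lp 𝕜 p μ) :
    ‖(LpPi.tprod u : LpPi 𝕜 d p μ)‖ ≤ ∏ i, ‖u i‖ :=
  (UniformSpace.Completion.norm_coe _).trans_le (PiTensorProduct.projectiveSeminorm_tprod_le u)

/-- Every element of the projective tensor power is the sum of a countable, absolutely convergent
series of multiples of elementary tensors of vectors of norm at most one. -/
theorem exists_representation (f : LpPi 𝕜 d p μ) :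
    ∃ (N : ℕ → ℕ) (c : (Σ n, Fin (N n)) → 𝕜) (u : (Σ n, Fin (N n)) → Fin d → Lp 𝕜 p μ),
      (∀ j i, ‖u j i‖ ≤ 1) ∧ Summable (fun j => ‖c j‖) ∧
      HasSum (fun j => c j • (LpPi.tprod (u j) : LpPi 𝕜 d p μ)) f := by
  let S : AddSubgroup (LpPi 𝕜 d p μ) := (UniformSpace.Completion.toComplL (𝕜 := 𝕜)
    (E := ⨂[𝕜] _ : Fin d, Lp 𝕜 p μ)).toLinearMap.toAddMonoidHom.range
  have hS : f ∈ closure (S : Set (LpPi 𝕜 d p μ)) :=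
    (UniformSpace.Completion.denseRange_coe (α := ⨂[𝕜] _ : Fin d, Lp 𝕜 p μ)) f
  obtain ⟨v, hv, hvS, -, hvn⟩ := controlled_sum_of_mem_closure hS
    (b := fun n => (1 / 2 : ℝ) ^ n) (fun n => by positivity)
  choose x hx using hvS
  replace hx : ∀ n, (x n : LpPi 𝕜 d p μ) = v n := hx
  -- The telescoping series controls `v n` only for `n > 0`; the extra term at `0` makes room for `v
  -- 0`.
  set b : ℕ → ℝ := fun n => (1 / 2 : ℝ) ^ n + if n = 0 then ‖v 0‖ else 0 with hb
  have hbs : Summable b := summable_geometric_two.add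
    (summable_of_ne_finset_zero (s := {0}) fun n hn => by
      rw [if_neg (by simpa using hn)])
  have hxb : ∀ n, ‖x n‖ < b n := by
    intro n
    rw [← UniformSpace.Completion.norm_coe, hx]
    rcases Nat.eq_zero_or_pos n with rfl | hn
    · simp [hb]
    · simpa [hb, hn.ne'] using hvn n hn
  choose N c u hu hc he using fun n => exists_finite_representation (x n) (hxb n)
  have hcs : Summable (fun j : Σ n, Fin (N n) => ‖c j.1 j.2‖) := by
    rw [summable_sigma_of_nonneg fun _ => norm_nonneg _]
    refine ⟨fun n => (hasSum_fintype _).summable, ?_⟩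
    refine Summable.of_nonneg_of_le (fun n => tsum_nonneg fun _ => norm_nonneg _) (fun n => ?_) hbs
    rw [tsum_fintype]
    exact (hc n).le
  refine ⟨N, fun j => c j.1 j.2, fun j => u j.1 j.2, fun j => hu j.1 j.2, hcs, ?_⟩
  have hvs : Summable v := by
    refine Summable.of_norm (Summable.of_nonneg_of_le (fun _ => norm_nonneg _) (fun n => ?_) hbs)
    rw [← hx, UniformSpace.Completion.norm_coe]
    exact (hxb n).le
  have hvf : HasSum v f := by
    convert hvs.hasSum
    exact tendsto_nhds_unique hv (hvs.hasSum.tendsto_sum_nat.comp (tendsto_add_atTop_nat 1))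
  refine hvf.sigma_of_hasSum (fun n => ?_) ?_
  · have : ∑ j, c n j • (LpPi.tprod (u n j) : LpPi 𝕜 d p μ) = v n := by
      rw [← hx, ← he n]
      change _ = UniformSpace.Completion.toComplL (𝕜 := 𝕜) _
      simp only [map_sum, map_smul]
      rfl
    rw [← this]
    exact hasSum_fintype _
  · refine Summable.of_norm (Summable.of_nonneg_of_le (fun _ => norm_nonneg _) (fun j => ?_) hcs)
    rw [norm_smul]
    refine mul_le_of_le_one_right (norm_nonneg _) ((LpPi.norm_tprod_le _).trans ?_)
    exact Finset.prod_le_one (fun _ _ => norm_nonneg _) fun i _ => hu _ _ i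

end Representation

/-! ### Action of the operators on elementary tensors. -/

section Lift
variable {𝕜 : Type*} [RCLike 𝕜] {X : Type*} [MeasurableSpace X]
  {d : ℕ} {p r : ℝ≥0∞} [Fact (1 ≤ p)] [Fact (1 ≤ r)] {μ : Measure X}

theorem LpPi.lift_coe {F : Type*} [NormedAddCommGroup F] [NormedSpace 𝕜 F] [CompleteSpace F]
    (Φ : ContinuousMultilinearMap 𝕜 (fun _ : Fin d => Lp 𝕜 p μ) F)
    (x : ⨂[𝕜] _ : Fin d, Lp 𝕜 p μ) :
    LpPi.lift Φ (x : LpPi 𝕜 d p μ) = PiTensorProduct.lift Φ.toMultilinearMap x := by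
  have h := ContinuousLinearMap.extend_eq
    (PiTensorProduct.liftIsometry 𝕜 (fun _ : Fin d => Lp 𝕜 p μ) F Φ)
    (e := (UniformSpace.Completion.toComplL : _ →L[𝕜] LpPi 𝕜 d p μ))
    (UniformSpace.Completion.denseRange_coe)
    (UniformSpace.Completion.isUniformInducing_coe _) x
  rw [PiTensorProduct.liftIsometry_apply_apply] at h
  exact h

theorem LpPi.lift_tprod {F : Type*} [NormedAddCommGroup F] [NormedSpace 𝕜 F] [CompleteSpace F]
    (Φ : ContinuousMultilinearMap 𝕜 (fun _ : Fin d => Lp 𝕜 p μ) F)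
    (u : Fin d → Lp 𝕜 p μ) : LpPi.lift Φ (LpPi.tprod u) = Φ u :=
  (LpPi.lift_coe Φ _).trans (PiTensorProduct.lift.tprod _)

theorem LpPi.map_tprod (A : Fin d → (Lp 𝕜 p μ →L[𝕜] Lp 𝕜 p μ)) (u : Fin d → Lp 𝕜 p μ) :
    LpPi.map A (LpPi.tprod u) = LpPi.tprod fun i => A i (u i) :=
  LpPi.lift_tprod _ _

theorem koopman_pow_ae_eq {T : X → X} (hT : MeasurePreserving T μ μ) (k : ℕ) (u : Lp 𝕜 p μ) :
    (koopman 𝕜 p hT ^ k) u =ᵐ[μ] fun x => u (T^[k] x) := by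
  induction k with
  | zero => simp
  | succ k ih =>
    rw [pow_succ']
    have h1 : koopman 𝕜 p hT ((koopman 𝕜 p hT ^ k) u)
        =ᵐ[μ] ((koopman 𝕜 p hT ^ k) u : X → 𝕜) ∘ T := Lp.coeFn_compMeasurePreserving _ hT
    refine h1.trans ?_
    simpa [Function.comp_def] using hT.quasiMeasurePreserving.ae_eq_comp ih

theorem norm_koopman_pow {T : X → X} (hT : MeasurePreserving T μ μ) (k : ℕ) (u : Lp 𝕜 p μ) :
    ‖(koopman 𝕜 p hT ^ k) u‖ = ‖u‖ := by
  induction k with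
  | zero => simp
  | succ k ih =>
    rw [pow_succ', ← ih]
    exact (Lp.compMeasurePreservingₗᵢ 𝕜 T hT).norm_map _

variable (𝕜 p) in
/-- The ergodic averages `n⁻¹ ∑_{k < n} V^k` as operators on `L_p(μ)`. -/
def koopmanAverage {T : X → X} (hT : MeasurePreserving T μ μ) (n : ℕ) : Lp 𝕜 p μ →L[𝕜] Lp 𝕜 p μ :=
  (n : 𝕜)⁻¹ • ∑ k ∈ Finset.range n, koopman 𝕜 p hT ^ k

theorem koopmanAverage_ae_eq {T : X → X} (hT : MeasurePreserving T μ μ) (n : ℕ) (u : Lp 𝕜 p μ) :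
    koopmanAverage 𝕜 p hT n u =ᵐ[μ] birkhoffAverage 𝕜 T u n := by
  have h1 : ∀ᵐ x ∂μ, ∀ k, ((koopman 𝕜 p hT ^ k) u : X → 𝕜) x = u (T^[k] x) :=
    ae_all_iff.2 fun k => koopman_pow_ae_eq hT k u
  have h2 := Lp.coeFn_smul (n : 𝕜)⁻¹ (∑ k ∈ Finset.range n, (koopman 𝕜 p hT ^ k) u)
  have h3 := Lp.coeFn_finsetSum (Finset.range n) fun k => (koopman 𝕜 p hT ^ k) u
  simp only [koopmanAverage, smul_apply, sum_apply]
  filter_upwards [h1, h2, h3] with x e1 e2 e3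
  rw [e2, Pi.smul_apply, e3]
  simp only [Finset.sum_apply, e1, birkhoffAverage, birkhoffSum]

theorem norm_koopmanAverage_le {T : X → X} (hT : MeasurePreserving T μ μ) (n : ℕ)
    (u : Lp 𝕜 p μ) : ‖koopmanAverage 𝕜 p hT n u‖ ≤ ‖u‖ := by
  simp only [koopmanAverage, smul_apply, sum_apply]
  rw [norm_smul, norm_inv, RCLike.norm_natCast]
  have : ‖∑ k ∈ Finset.range n, (koopman 𝕜 p hT ^ k) u‖ ≤ n * ‖u‖ := by
    refine (norm_sum_le _ _).trans ?_
    simp only [norm_koopman_pow, Finset.sum_const, Finset.card_range, nsmul_eq_mul, le_refl]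
  rcases Nat.eq_zero_or_pos n with rfl | hn
  · simp
  · rwa [inv_mul_le_iff₀ (by exact_mod_cast hn)]

variable [IsProbabilityMeasure μ] (hr : r ≠ ∞) (hpr : p = r * d)

theorem diag_tprod (u : Fin d → Lp 𝕜 p μ) :
    diag μ hr hpr (LpPi.tprod u) = mulMultilinear μ hr hpr u :=
  LpPi.lift_tprod _ _

theorem mulMultilinear_ae_eq (u : Fin d → Lp 𝕜 p μ) :
    mulMultilinear μ hr hpr u =ᵐ[μ] fun x => ∏ i, u i x :=
  MemLp.coeFn_toLp (memLp_prod hr hpr u)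

theorem norm_mulMultilinear_le (u : Fin d → Lp 𝕜 p μ) :
    ‖mulMultilinear μ hr hpr u‖ ≤ ∏ i, ‖u i‖ := by
  have h : ‖mulMultilinear (𝕜 := 𝕜) μ hr hpr‖ ≤ 1 :=
    MultilinearMap.mkContinuous_norm_le _ zero_le_one _
  calc _ ≤ ‖mulMultilinear (𝕜 := 𝕜) μ hr hpr‖ * ∏ i, ‖u i‖ := ContinuousMultilinearMap.le_opNorm _ _
    _ ≤ 1 * ∏ i, ‖u i‖ := by gcongr
    _ = _ := one_mul _

/-- Multilinearity expands a product of `d` sums into the sum over the box. -/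
theorem ergodicAverage_tprod {T : Fin d → X → X} (hT : ∀ i, MeasurePreserving (T i) μ μ)
    (u : Fin d → Lp 𝕜 p μ) (n : Fin d → ℕ) :
    ergodicAverage hr hpr hT (LpPi.tprod u) n
      = mulMultilinear μ hr hpr fun i => koopmanAverage 𝕜 p (hT i) (n i) (u i) := by
  simp only [ergodicAverage, koopmanPi, LpPi.map_tprod, diag_tprod, koopmanAverage,
    smul_apply, sum_apply]
  rw [ContinuousMultilinearMap.map_smul_univ, ContinuousMultilinearMap.map_sum_finset,
    Finset.prod_inv_distrib]

theorem condExpInv_ae_eq {T : X → X} (u : Lp 𝕜 p μ) :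
    condExpInv 𝕜 μ p T u =ᵐ[μ] μ[u | MeasurableSpace.invariants T] :=
  MemLp.coeFn_toLp ((Lp.memLp u).condExp Fact.out)

theorem tendsto_birkhoffAverage_Lp {T : X → X} (hT : MeasurePreserving T μ μ) (u : Lp 𝕜 p μ) :
    ∀ᵐ x ∂μ, Tendsto (fun n => birkhoffAverage 𝕜 T u n x) atTop
      (𝓝 ((condExpInv 𝕜 μ p T u : X → 𝕜) x)) := by
  filter_upwards [tendsto_birkhoffAverage hT (Lp.stronglyMeasurable u).measurable
    ((Lp.memLp u).integrable Fact.out), condExpInv_ae_eq u] with x h1 h2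
  rwa [h2]

end Lift

/-! ### Interchange of limits and pointwise estimates. -/

section Auxiliary

/-- A three-term estimate. The threshold for `n` may depend on `ε`, so no domination uniform in all
`n` is required; the tails of `b` inherit their bound in the limit. -/
theorem tendsto_of_hasSum_of_small_tails {ι N E : Type*} [NormedAddCommGroup E] {l : Filter N}
    [l.NeBot] {a : N → ι → E} {b : ι → E} {A : N → E} {B : E} (ha : ∀ n, HasSum (a n) (A n))
    (hb : HasSum b B) (hab : ∀ j, Tendsto (fun n => a n j) l (𝓝 (b j)))
    (htail : ∀ ε > 0, ∃ s : Finset ι, ∀ᶠ n in l, ∀ t : Finset ι, Disjoint t s →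
      ‖∑ j ∈ t, a n j‖ ≤ ε) : Tendsto A l (𝓝 B) := by
  classical
  have key : ∀ (s : Finset ι) (ε : ℝ) (g : ι → E) (G : E), HasSum g G →
      (∀ t : Finset ι, Disjoint t s → ‖∑ j ∈ t, g j‖ ≤ ε) → ‖G - ∑ j ∈ s, g j‖ ≤ ε := by
    intro s ε g G hg ht
    have h1 : Tendsto (fun t : Finset ι => ‖∑ j ∈ t, g j - ∑ j ∈ s, g j‖) atTop
        (𝓝 ‖G - ∑ j ∈ s, g j‖) := (Tendsto.sub_const hg _).norm
    refine le_of_tendsto h1 ?_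
    filter_upwards [eventually_ge_atTop s] with t hst
    rw [← Finset.sum_sdiff_eq_sub hst]
    exact ht _ Finset.sdiff_disjoint
  rw [Metric.tendsto_nhds]
  intro ε hε
  obtain ⟨s, hs⟩ := htail (ε / 4) (by positivity)
  have hB : ‖B - ∑ j ∈ s, b j‖ ≤ ε / 4 := by
    refine key s _ b B hb fun t ht => ?_
    refine le_of_tendsto (tendsto_finsetSum t fun j _ => hab j).norm ?_
    filter_upwards [hs] with n hn using hn t ht
  have hfin := Metric.tendsto_nhds.1 (tendsto_finsetSum s fun j _ => hab j) (ε / 4) (by positivity)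
  filter_upwards [hs, hfin] with n hn h1
  have hA := key s _ (a n) (A n) (ha n) hn
  rw [dist_eq_norm] at h1 ⊢
  have e : A n - B = (A n - ∑ j ∈ s, a n j) + (∑ j ∈ s, a n j - ∑ j ∈ s, b j)
      - (B - ∑ j ∈ s, b j) := by abel
  rw [e]
  have h2 := norm_sub_le ((A n - ∑ j ∈ s, a n j) + (∑ j ∈ s, a n j - ∑ j ∈ s, b j))
    (B - ∑ j ∈ s, b j)
  have h3 := norm_add_le (A n - ∑ j ∈ s, a n j) (∑ j ∈ s, a n j - ∑ j ∈ s, b j)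
  linarith

/-- Every factor is at most the largest one. This decouples the `d` time parameters. For `d = 0` the
empty product `1` would exceed the empty sum. -/
theorem prod_le_sum_pow {d : ℕ} (hd : d ≠ 0) (a : Fin d → ℝ) (ha : ∀ i, 0 ≤ a i) :
    ∏ i, a i ≤ ∑ i, a i ^ d := by
  have : NeZero d := ⟨hd⟩
  obtain ⟨i₀, -, h⟩ := Finset.exists_max_image Finset.univ a Finset.univ_nonempty
  calc ∏ i, a i ≤ ∏ _i : Fin d, a i₀ :=
        Finset.prod_le_prod (fun i _ => ha i) fun i _ => h i (Finset.mem_univ i)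
    _ = a i₀ ^ d := by simp
    _ ≤ ∑ i, a i ^ d := Finset.single_le_sum (f := fun i => a i ^ d)
        (fun i _ => pow_nonneg (ha i) d) (Finset.mem_univ i₀)

/-- Jensen's inequality for `t ↦ t ^ d` with weights `1 / n`. -/
theorem norm_birkhoffAverage_pow_le {X 𝕜 : Type*} [RCLike 𝕜] (T : X → X) (v : X → 𝕜) {d : ℕ}
    (hd : d ≠ 0) (n : ℕ) (x : X) :
    ‖birkhoffAverage 𝕜 T v n x‖ ^ d ≤ birkhoffAverage ℝ T (fun y => ‖v y‖ ^ d) n x := by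
  rcases Nat.eq_zero_or_pos n with rfl | hn
  · simp [hd]
  have hn' : (n : ℝ) ≠ 0 := by exact_mod_cast hn.ne'
  have h1 : ‖birkhoffAverage 𝕜 T v n x‖ ≤ ∑ k ∈ Finset.range n, (n : ℝ)⁻¹ * ‖v (T^[k] x)‖ := by
    rw [birkhoffAverage, norm_smul, norm_inv, RCLike.norm_natCast, ← Finset.mul_sum]
    gcongr
    exact norm_sum_le _ _
  refine (pow_le_pow_left₀ (norm_nonneg _) h1 d).trans ?_
  refine (Real.pow_arith_mean_le_arith_mean_pow _ _ _ (fun _ _ => by positivity) ?_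
    (fun _ _ => norm_nonneg _) d).trans_eq ?_
  · simp [hn']
  · simp [birkhoffAverage, birkhoffSum, Finset.mul_sum]

variable {𝕜 : Type*} [RCLike 𝕜] {X : Type*} [MeasurableSpace X] {μ : Measure X}
  [IsProbabilityMeasure μ]

/-- Since `‖·‖_1 ≤ ‖·‖_r`, the sum of the absolute values is integrable, hence finite almost
everywhere. The pointwise sum is identified with `f` along a sequence of partial sums converging
almost everywhere. -/
theorem hasSum_ae_of_hasSum_Lp {ι : Type*} [Countable ι] {r : ℝ≥0∞} [Fact (1 ≤ r)]
    {g : ι → Lp 𝕜 r μ} {f : Lp 𝕜 r μ} (hg : Summable fun j => ‖g j‖) (hf : HasSum g f) :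
    ∀ᵐ x ∂μ, HasSum (fun j => (g j : X → 𝕜) x) ((f : X → 𝕜) x) := by
  have h1 : ∫⁻ x, ∑' j, ‖(g j : X → 𝕜) x‖ₑ ∂μ ≠ ∞ := by
    rw [lintegral_tsum fun j => (Lp.aestronglyMeasurable (g j)).enorm]
    refine ne_top_of_le_ne_top hg.tsum_ofReal_ne_top (ENNReal.tsum_le_tsum fun j => ?_)
    rw [← eLpNorm_one_eq_lintegral_enorm, ofReal_norm, Lp.enorm_def]
    exact eLpNorm_le_eLpNorm_of_exponent_le Fact.out (Lp.aestronglyMeasurable _)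
  have h2 : ∀ᵐ x ∂μ, ∑' j, ‖(g j : X → 𝕜) x‖ₑ < ∞ :=
    ae_lt_top' (AEMeasurable.tsum fun j => (Lp.aestronglyMeasurable (g j)).enorm) h1
  obtain ⟨ns, hns, h3⟩ := (tendstoInMeasure_of_tendsto_Lp hf).exists_seq_tendsto_ae'
  have h4 : ∀ᵐ x ∂μ, ∀ m, ((∑ j ∈ ns m, g j : Lp 𝕜 r μ) : X → 𝕜) x
      = ∑ j ∈ ns m, (g j : X → 𝕜) x := ae_all_iff.2 fun m => by
    filter_upwards [Lp.coeFn_finsetSum (ns m) g] with x hx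
    simpa using hx
  filter_upwards [h2, h3, h4] with x e2 e3 e4
  have hs : Summable fun j => (g j : X → 𝕜) x := by
    refine Summable.of_norm ?_
    have := ENNReal.summable_toReal e2.ne
    simpa using this
  convert hs.hasSum
  refine tendsto_nhds_unique e3 ?_
  simp only [e4]
  have h5 : Tendsto (fun t : Finset ι => ∑ j ∈ t, (g j : X → 𝕜) x) atTop _ := hs.hasSum
  exact h5.comp hns

/-- By Markov's inequality `{H s ≥ δ}` can be made arbitrarily small; the exceptional set lies in
all of these sets. The `s` obtained depends on the point. -/
theorem ae_forall_exists_lt {κ : Type*} [Countable κ] {H : κ → X → ℝ}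
    (hi : ∀ s, Integrable (H s) μ) (h0 : ∀ s, 0 ≤ᵐ[μ] H s)
    (hsmall : ∀ ε > 0, ∃ s, ∫ x, H s x ∂μ < ε) :
    ∀ᵐ x ∂μ, ∀ ε > 0, ∃ s, H s x < ε := by
  have key : ∀ m : ℕ, ∀ᵐ x ∂μ, ∃ s, H s x < 1 / ((m : ℝ) + 1) := by
    intro m
    set δ : ℝ := 1 / ((m : ℝ) + 1) with hδ
    have hδ0 : 0 < δ := by positivity
    have hB : μ.real {x | ¬ ∃ s, H s x < δ} ≤ 0 := by
      refine le_of_forall_pos_le_add fun ε hε => ?_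
      obtain ⟨s, hs⟩ := hsmall (δ * ε) (by positivity)
      have h1 := mul_meas_ge_le_integral_of_nonneg (h0 s) (hi s) δ
      have h2 : μ.real {x | ¬ ∃ s, H s x < δ} ≤ μ.real {x | δ ≤ H s x} :=
        measureReal_mono fun x hx => not_lt.1 fun h => hx ⟨s, h⟩
      have h3 : μ.real {x | δ ≤ H s x} < ε := lt_of_mul_lt_mul_left (h1.trans_lt hs) hδ0.le
      linarith
    have h0 : μ.real {x | ¬ ∃ s, H s x < δ} = 0 := le_antisymm hB measureReal_nonneg
    exact (measureReal_eq_zero_iff).1 h0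
  filter_upwards [ae_all_iff.2 key] with x hx ε hε
  obtain ⟨m, hm⟩ := exists_nat_one_div_lt hε
  obtain ⟨s, hs⟩ := hx m
  exact ⟨s, hs.trans hm⟩

end Auxiliary

/-! ### The mean ergodic theorem. -/

section MeanErgodic

variable {𝕜 : Type*} [RCLike 𝕜] {X : Type*} [MeasurableSpace X] {μ : Measure X}
  [IsProbabilityMeasure μ] {p : ℝ≥0∞} [Fact (1 ≤ p)]

/-- The mean ergodic theorem in `L_p`. -/
theorem tendsto_koopmanAverage (hp : p ≠ ∞) {T : X → X} (hT : MeasurePreserving T μ μ)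
    (u : Lp 𝕜 p μ) :
    Tendsto (fun n => koopmanAverage 𝕜 p hT n u) atTop (𝓝 (condExpInv 𝕜 μ p T u)) := by
  rw [Lp.tendsto_Lp_iff_tendsto_eLpNorm']
  -- The functions `u ∘ T^[k]` are identically distributed, hence uniformly integrable in `L_p`; so
  -- are their averages, and Vitali's theorem upgrades almost sure convergence to norm convergence.
  have hui : UniformIntegrable (fun (k : ℕ) x => (u : X → 𝕜) (T^[k] x)) p μ := by
    refine ProbabilityTheory.MemLp.uniformIntegrable_of_identDistrib (j := 0) Fact.out hp
      (by simpa using Lp.memLp u) fun k => ?_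
    have hm := (Lp.stronglyMeasurable u).measurable
    refine ⟨(hm.comp (hT.measurable.iterate k)).aemeasurable,
      (hm.comp (hT.measurable.iterate 0)).aemeasurable, ?_⟩
    change μ.map (u ∘ T^[k]) = μ.map (u ∘ T^[0])
    rw [← Measure.map_map hm (hT.measurable.iterate k), (hT.iterate k).map_eq,
      ← Measure.map_map hm (hT.measurable.iterate 0), (hT.iterate 0).map_eq]
  have hav := uniformIntegrable_average (E := 𝕜) Fact.out hui
  have e : (fun n : ℕ => (n : ℝ)⁻¹ • ∑ i ∈ Finset.range n, fun x => (u : X → 𝕜) (T^[i] x))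
      = fun n => birkhoffAverage 𝕜 T u n := by
    funext n x
    rw [birkhoffAverage_congr_ring 𝕜 ℝ]
    simp [birkhoffAverage, birkhoffSum]
  rw [e] at hav
  refine tendsto_Lp_finite_of_tendsto_ae Fact.out hp (fun n => Lp.aestronglyMeasurable _)
    (Lp.memLp _) (hav.unifIntegrable.ae_eq fun n => (koopmanAverage_ae_eq hT n u).symm) ?_
  filter_upwards [tendsto_birkhoffAverage_Lp hT u,
    ae_all_iff.2 fun n => koopmanAverage_ae_eq hT n u] with x h1 h2
  simpa only [h2] using h1

end MeanErgodic

/-! ### Termwise series and norm convergence. -/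

section Series

variable {𝕜 : Type*} [RCLike 𝕜] {X : Type*} [MeasurableSpace X] {μ : Measure X}
  [IsProbabilityMeasure μ] {d : ℕ} {p r : ℝ≥0∞} [Fact (1 ≤ p)] [Fact (1 ≤ r)]
  (hr : r ≠ ∞) (hpr : p = r * d) {T : Fin d → X → X} (hT : ∀ i, MeasurePreserving (T i) μ μ)
  {ι : Type*} {c : ι → 𝕜} {u : ι → Fin d → Lp 𝕜 p μ} {f : LpPi 𝕜 d p μ}

theorem hasSum_ergodicAverage (hf : HasSum (fun j => c j • (LpPi.tprod (u j) : LpPi 𝕜 d p μ)) f)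
    (n : Fin d → ℕ) :
    HasSum (fun j => c j •
      mulMultilinear μ hr hpr fun i => koopmanAverage 𝕜 p (hT i) (n i) (u j i))
      (ergodicAverage hr hpr hT f n) := by
  let L : LpPi 𝕜 d p μ →L[𝕜] Lp 𝕜 r μ :=
    (∏ i, (n i : 𝕜))⁻¹ • ∑ k ∈ Fintype.piFinset fun i => Finset.range (n i),
      (diag μ hr hpr).comp (koopmanPi 𝕜 p hT k)
  have hL : ∀ g, L g = ergodicAverage hr hpr hT g n := fun g => by
    simp [L, ergodicAverage]
  have := L.hasSum hf
  simp only [map_smul] at this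
  simpa only [hL, ergodicAverage_tprod] using this

theorem hasSum_diag_condExpInv
    (hf : HasSum (fun j => c j • (LpPi.tprod (u j) : LpPi 𝕜 d p μ)) f) :
    HasSum (fun j => c j • mulMultilinear μ hr hpr fun i => condExpInv 𝕜 μ p (T i) (u j i))
      (diag μ hr hpr (LpPi.map (fun i => condExpInv 𝕜 μ p (T i)) f)) := by
  have := (diag μ hr hpr).hasSum ((LpPi.map fun i => condExpInv 𝕜 μ p (T i)).hasSum hf)
  simpa only [map_smul, LpPi.map_tprod, diag_tprod] using this

theorem norm_smul_mulMultilinear_le (c : 𝕜) {v : Fin d → Lp 𝕜 p μ} (hv : ∀ i, ‖v i‖ ≤ 1) :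
    ‖c • mulMultilinear μ hr hpr v‖ ≤ ‖c‖ := by
  rw [norm_smul]
  exact mul_le_of_le_one_right (norm_nonneg _) ((norm_mulMultilinear_le hr hpr v).trans
    (Finset.prod_le_one (fun _ _ => norm_nonneg _) fun i _ => hv i))

theorem norm_condExpInv_le {T : X → X} (v : Lp 𝕜 p μ) : ‖condExpInv 𝕜 μ p T v‖ ≤ ‖v‖ := by
  rw [Lp.norm_def, Lp.norm_def, eLpNorm_congr_ae (condExpInv_ae_eq v)]
  exact ENNReal.toReal_mono (Lp.eLpNorm_ne_top v) (eLpNorm_condExp_le_eLpNorm _ Fact.out)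

/-- Norm convergence of the ergodic averages. -/
theorem tendsto_ergodicAverage (f : LpPi 𝕜 d p μ) :
    Tendsto (fun n : Fin d → ℕ => ergodicAverage hr hpr hT f n) (Filter.pi fun _ => atTop)
      (𝓝 (diag μ hr hpr (LpPi.map (fun i => condExpInv 𝕜 μ p (T i)) f))) := by
  obtain ⟨N, c, u, hu, hc, hf⟩ := exists_representation f
  have hp : p ≠ ∞ := hpr ▸ ENNReal.mul_ne_top hr (ENNReal.natCast_ne_top d)
  rw [← (hasSum_diag_condExpInv hr hpr hf).tsum_eq]
  simp only [← (hasSum_ergodicAverage hr hpr hT hf _).tsum_eq]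
  -- All averages are contractions, so `‖c j‖` dominates the `j`-th term for every `n`.
  refine tendsto_tsum_of_dominated_convergence hc (fun j => ?_) (Eventually.of_forall fun n j =>
    norm_smul_mulMultilinear_le hr hpr _ fun i => (norm_koopmanAverage_le _ _ _).trans (hu j i))
  refine Tendsto.const_smul (((mulMultilinear μ hr hpr).cont.tendsto _).comp
    (tendsto_pi_nhds.2 fun i => ?_)) _
  exact (tendsto_koopmanAverage hp (hT i) (u j i)).comp (tendsto_eval_pi _ i)

end Series

/-! ### Integrability of the tail functions. -/

section Tail

variable {𝕜 : Type*} [RCLike 𝕜] {X : Type*} [MeasurableSpace X] {μ : Measure X}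
  {p : ℝ≥0∞} {ι : Type*}

/-- The tail `∑_{j ∉ s} |c_j| |v_j|^d`, with values in `[0, ∞]`. -/
def powTail (d : ℕ) (c : ι → 𝕜) (v : ι → Lp 𝕜 p μ) (s : Finset ι) (x : X) : ℝ≥0∞ :=
  ∑' j : {j // j ∉ s}, ‖c j‖ₑ * ‖(v j : X → 𝕜) x‖ₑ ^ d

theorem measurable_powTail [Countable ι] (d : ℕ) (c : ι → 𝕜) (v : ι → Lp 𝕜 p μ) (s : Finset ι) :
    Measurable (powTail d c v s) :=
  Measurable.tsum fun j =>
    ((Lp.stronglyMeasurable (v j)).measurable.enorm.pow_const d).const_mul _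

/-- On a probability space `‖v j‖_d ≤ ‖v j‖_p ≤ 1` because `d ≤ p`, so each `|v j| ^ d` has integral
at most `1`. -/
theorem lintegral_powTail_le [IsProbabilityMeasure μ] [Countable ι] {d : ℕ} (hd : d ≠ 0)
    (hdp : (d : ℝ≥0∞) ≤ p) (c : ι → 𝕜) {v : ι → Lp 𝕜 p μ} (hv : ∀ j, ‖v j‖ ≤ 1) (s : Finset ι) :
    ∫⁻ x, powTail d c v s x ∂μ ≤ ∑' j : {j // j ∉ s}, ‖c j‖ₑ := by
  simp only [powTail]
  have hm : ∀ j, Measurable fun x => ‖(v j : X → 𝕜) x‖ₑ ^ d := fun j =>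
    (Lp.stronglyMeasurable (v j)).measurable.enorm.pow_const d
  rw [lintegral_tsum fun j : {j // j ∉ s} => ((hm j).const_mul _).aemeasurable]
  refine ENNReal.tsum_le_tsum fun j => ?_
  rw [lintegral_const_mul _ (hm j)]
  refine mul_le_of_le_one_right' ?_
  have h1 : eLpNorm (v j) d μ ≤ 1 := by
    refine (eLpNorm_le_eLpNorm_of_exponent_le hdp (Lp.aestronglyMeasurable _)).trans ?_
    rw [← ENNReal.ofReal_toReal (Lp.eLpNorm_ne_top (v j)), ← Lp.norm_def]
    exact ENNReal.ofReal_le_one.2 (hv j)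
  have h2 := eLpNorm_nnreal_pow_eq_lintegral (μ := μ) (f := (v j : X → 𝕜)) (p := (d : NNReal))
    (by exact_mod_cast hd)
  simp only [NNReal.coe_natCast, ENNReal.rpow_natCast, ENNReal.coe_natCast] at h2
  rw [← h2]
  exact pow_le_one₀ zero_le h1

theorem sum_le_toReal_powTail {d : ℕ} (c : ι → 𝕜) (v : ι → Lp 𝕜 p μ) {s t : Finset ι}
    (hts : Disjoint t s) {x : X} (hx : powTail d c v s x ≠ ∞) :
    ∑ j ∈ t, ‖c j‖ * ‖(v j : X → 𝕜) x‖ ^ d ≤ (powTail d c v s x).toReal := by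
  classical
  have h : ∑ j ∈ t, ‖c j‖ₑ * ‖(v j : X → 𝕜) x‖ₑ ^ d ≤ powTail d c v s x := by
    have ht : ∀ j ∈ t, j ∉ s := fun j hj => Finset.disjoint_left.1 hts hj
    rw [← Finset.sum_subtype_of_mem (p := fun j => j ∉ s) _ ht]
    exact ENNReal.sum_le_tsum _
  have h' := ENNReal.toReal_mono hx h
  rw [ENNReal.toReal_sum fun j _ => by finiteness] at h'
  simpa using h'

theorem tendsto_tsum_enorm_compl {c : ι → 𝕜} (hc : Summable fun j => ‖c j‖) :
    Tendsto (fun s : Finset ι => (∑' j : {j // j ∉ s}, ‖c j‖ₑ).toReal) atTop (𝓝 0) := by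
  have h1 : ∑' j, ‖c j‖ₑ ≠ ∞ := by simpa using hc.tsum_ofReal_ne_top
  have := ENNReal.tendsto_tsum_compl_atTop_zero h1
  exact (ENNReal.tendsto_toReal ENNReal.zero_ne_top).comp this

variable [IsProbabilityMeasure μ] [Countable ι] {d : ℕ} {c : ι → 𝕜} {v : ι → Lp 𝕜 p μ}

theorem lintegral_powTail_ne_top (hd : d ≠ 0) (hdp : (d : ℝ≥0∞) ≤ p)
    (hc : Summable fun j => ‖c j‖) (hv : ∀ j, ‖v j‖ ≤ 1) (s : Finset ι) :
    ∫⁻ x, powTail d c v s x ∂μ ≠ ∞ := by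
  refine ne_top_of_le_ne_top ?_ (lintegral_powTail_le hd hdp c hv s)
  simpa using (hc.subtype fun j => j ∉ s).tsum_ofReal_ne_top

theorem integrable_toReal_powTail (hd : d ≠ 0) (hdp : (d : ℝ≥0∞) ≤ p)
    (hc : Summable fun j => ‖c j‖) (hv : ∀ j, ‖v j‖ ≤ 1) (s : Finset ι) :
    Integrable (fun x => (powTail d c v s x).toReal) μ :=
  integrable_toReal_of_lintegral_ne_top (measurable_powTail d c v s).aemeasurable
    (lintegral_powTail_ne_top hd hdp hc hv s)

theorem integral_toReal_powTail_le (hd : d ≠ 0) (hdp : (d : ℝ≥0∞) ≤ p)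
    (hc : Summable fun j => ‖c j‖) (hv : ∀ j, ‖v j‖ ≤ 1) (s : Finset ι) :
    ∫ x, (powTail d c v s x).toReal ∂μ ≤ (∑' j : {j // j ∉ s}, ‖c j‖ₑ).toReal := by
  have hm := measurable_powTail d c v s
  have hf := lintegral_powTail_ne_top hd hdp hc hv s
  rw [integral_toReal hm.aemeasurable (ae_lt_top hm hf)]
  refine ENNReal.toReal_mono ?_ (lintegral_powTail_le hd hdp c hv s)
  simpa using (hc.subtype fun j => j ∉ s).tsum_ofReal_ne_top

end Tail

/-! ### Almost sure convergence. -/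

section Pointwise

variable {𝕜 : Type*} [RCLike 𝕜] {X : Type*} [MeasurableSpace X] {μ : Measure X}
  {d : ℕ} {p : ℝ≥0∞} {ι : Type*}

/-- The bound does not depend on `t`, and each summand depends on one `n i` only. Finiteness is
required along the orbits because `toReal` sends `∞` to `0`. -/
theorem norm_sum_smul_prod_birkhoffAverage_le (hd : d ≠ 0) {T : Fin d → X → X} {c : ι → 𝕜}
    {u : ι → Fin d → Lp 𝕜 p μ} {s t : Finset ι} (hts : Disjoint t s) {x : X}
    (hx : ∀ i k, powTail d c (fun j => u j i) s ((T i)^[k] x) ≠ ∞) (n : Fin d → ℕ) :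
    ‖∑ j ∈ t, c j * ∏ i, birkhoffAverage 𝕜 (T i) (u j i : X → 𝕜) (n i) x‖ ≤
      ∑ i, birkhoffAverage ℝ (T i) (fun y => (powTail d c (fun j => u j i) s y).toReal) (n i) x := by
  calc _ ≤ ∑ j ∈ t, ‖c j‖ * ∑ i, birkhoffAverage ℝ (T i)
          (fun y => ‖(u j i : X → 𝕜) y‖ ^ d) (n i) x := by
        refine norm_sum_le_of_le _ fun j _ => ?_
        rw [norm_mul, norm_prod]
        gcongr
        refine (prod_le_sum_pow hd _ fun i => norm_nonneg _).trans ?_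
        exact Finset.sum_le_sum fun i _ => norm_birkhoffAverage_pow_le _ _ hd _ _
    _ = ∑ i, birkhoffAverage ℝ (T i)
          (fun y => ∑ j ∈ t, ‖c j‖ * ‖(u j i : X → 𝕜) y‖ ^ d) (n i) x := by
        simp only [Finset.mul_sum]
        rw [Finset.sum_comm]
        refine Finset.sum_congr rfl fun i _ => ?_
        simp only [birkhoffAverage, birkhoffSum, smul_eq_mul]
        rw [Finset.sum_comm, Finset.mul_sum]
        refine Finset.sum_congr rfl fun j _ => ?_
        rw [← Finset.mul_sum]
        ring
    _ ≤ _ := by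
        refine Finset.sum_le_sum fun i _ => ?_
        simp only [birkhoffAverage, birkhoffSum, smul_eq_mul]
        gcongr with k _
        exact sum_le_toReal_powTail c (fun j => u j i) hts (hx i k)

variable [IsProbabilityMeasure μ]

/-- Conditional expectation preserves integrals, so the sum over `i` has integral at most `d` times
the tail of `∑ ‖c j‖`, which tends to `0`. -/
theorem ae_forall_exists_sum_condExp_powTail_lt [Countable ι] (hd : d ≠ 0)
    (hdp : (d : ℝ≥0∞) ≤ p) {c : ι → 𝕜} (hc : Summable fun j => ‖c j‖)
    {u : ι → Fin d → Lp 𝕜 p μ} (hu : ∀ j i, ‖u j i‖ ≤ 1) (T : Fin d → X → X) :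
    ∀ᵐ x ∂μ, ∀ ε > 0, ∃ s : Finset ι, ∑ i, (μ[fun y => (powTail d c (fun j => u j i) s y).toReal |
      MeasurableSpace.invariants (T i)]) x < ε := by
  refine ae_forall_exists_lt (fun s => integrable_finsetSum _ fun i _ => integrable_condExp)
    (fun s => ?_) fun ε hε => ?_
  · have : ∀ i, 0 ≤ᵐ[μ] μ[fun y => (powTail d c (fun j => u j i) s y).toReal |
        MeasurableSpace.invariants (T i)] := fun i =>
      condExp_nonneg (ae_of_all _ fun x => ENNReal.toReal_nonneg)
    filter_upwards [ae_all_iff.2 this] with x hx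
    exact Finset.sum_nonneg fun i _ => hx i
  · have h1 : Tendsto (fun s : Finset ι => d * (∑' j : {j // j ∉ s}, ‖c j‖ₑ).toReal) atTop
        (𝓝 (d * 0)) := (tendsto_tsum_enorm_compl hc).const_mul _
    rw [mul_zero] at h1
    obtain ⟨s, hs⟩ := (h1.eventually (gt_mem_nhds hε)).exists
    refine ⟨s, lt_of_le_of_lt ?_ hs⟩
    rw [integral_finsetSum _ fun i _ => integrable_condExp]
    calc _ ≤ ∑ _i : Fin d, (∑' j : {j // j ∉ s}, ‖c j‖ₑ).toReal := by
          refine Finset.sum_le_sum fun i _ => ?_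
          rw [integral_condExp (MeasurableSpace.invariants_le (T i))]
          exact integral_toReal_powTail_le hd hdp hc (fun j => hu j i) s
      _ = _ := by simp

variable {r : ℝ≥0∞} [Fact (1 ≤ p)] [Fact (1 ≤ r)]
  (hr : r ≠ ∞) (hpr : p = r * d) {T : Fin d → X → X} (hT : ∀ i, MeasurePreserving (T i) μ μ)

theorem ae_hasSum_mul_prod [Countable ι] {c : ι → 𝕜} (hc : Summable fun j => ‖c j‖)
    {w : ι → Fin d → Lp 𝕜 p μ} (hw : ∀ j i, ‖w j i‖ ≤ 1) {F : Lp 𝕜 r μ}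
    (hF : HasSum (fun j => c j • mulMultilinear μ hr hpr (w j)) F) :
    ∀ᵐ x ∂μ, HasSum (fun j => c j * ∏ i, (w j i : X → 𝕜) x) ((F : X → 𝕜) x) := by
  have h1 : Summable fun j => ‖c j • mulMultilinear μ hr hpr (w j)‖ :=
    Summable.of_nonneg_of_le (fun _ => norm_nonneg _)
      (fun j => norm_smul_mulMultilinear_le hr hpr _ (hw j)) hc
  filter_upwards [hasSum_ae_of_hasSum_Lp h1 hF,
    ae_all_iff.2 fun j => Lp.coeFn_smul (c j) (mulMultilinear μ hr hpr (w j)),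
    ae_all_iff.2 fun j => mulMultilinear_ae_eq hr hpr (w j)] with x e1 e2 e3
  simpa only [e2, Pi.smul_apply, e3, smul_eq_mul] using e1

/-- Almost sure convergence of the ergodic averages. -/
theorem ae_tendsto_ergodicAverage (f : LpPi 𝕜 d p μ) :
    ∀ᵐ x ∂μ, Tendsto (fun n : Fin d → ℕ => (ergodicAverage hr hpr hT f n : X → 𝕜) x)
      (Filter.pi fun _ => atTop)
      (𝓝 ((diag μ hr hpr (LpPi.map (fun i => condExpInv 𝕜 μ p (T i)) f) : X → 𝕜) x)) := by
  obtain ⟨N, c, u, hu, hc, hf⟩ := exists_representation f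
  have hp1 : (1 : ℝ≥0∞) ≤ p := Fact.out
  have hd : d ≠ 0 := by
    rintro rfl
    simp [hpr] at hp1
  have hdp : (d : ℝ≥0∞) ≤ p := hpr ▸ le_mul_of_one_le_left' Fact.out
  -- There are countably many `n`, so one null set serves them all; the same holds below for the
  -- indices `j` and the finite sets `s`.
  have hA : ∀ᵐ x ∂μ, ∀ n : Fin d → ℕ, HasSum
      (fun j => c j * ∏ i, birkhoffAverage 𝕜 (T i) (u j i : X → 𝕜) (n i) x)
      ((ergodicAverage hr hpr hT f n : X → 𝕜) x) := by
    refine ae_all_iff.2 fun n => ?_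
    filter_upwards [ae_hasSum_mul_prod hr hpr hc
      (fun j i => (norm_koopmanAverage_le (hT i) (n i) _).trans (hu j i))
      (hasSum_ergodicAverage hr hpr hT hf n),
      ae_all_iff.2 fun j => ae_all_iff.2 fun i => koopmanAverage_ae_eq (hT i) (n i) (u j i)]
      with x e1 e2
    simpa only [e2] using e1
  have hB := ae_hasSum_mul_prod hr hpr hc
    (fun j i => (norm_condExpInv_le (T := T i) _).trans (hu j i))
    (hasSum_diag_condExpInv hr hpr (T := T) hf)
  have hAB : ∀ᵐ x ∂μ, ∀ j i, Tendsto (fun n => birkhoffAverage 𝕜 (T i) (u j i) n x) atTop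
      (𝓝 ((condExpInv 𝕜 μ p (T i) (u j i) : X → 𝕜) x)) :=
    ae_all_iff.2 fun j => ae_all_iff.2 fun i => tendsto_birkhoffAverage_Lp (hT i) (u j i)
  have hG : ∀ᵐ x ∂μ, ∀ s i, Tendsto (fun n => birkhoffAverage ℝ (T i)
      (fun y => (powTail d c (fun j => u j i) s y).toReal) n x) atTop
      (𝓝 ((μ[fun y => (powTail d c (fun j => u j i) s y).toReal |
        MeasurableSpace.invariants (T i)]) x)) :=
    ae_all_iff.2 fun s => ae_all_iff.2 fun i => tendsto_birkhoffAverage_real (hT i)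
      (measurable_powTail _ _ _ _).ennreal_toReal
      (integrable_toReal_powTail hd hdp hc (fun j => hu j i) s)
  have hfin : ∀ᵐ x ∂μ, ∀ s i k, powTail d c (fun j => u j i) s ((T i)^[k] x) ≠ ∞ := by
    refine ae_all_iff.2 fun s => ae_all_iff.2 fun i => ae_all_iff.2 fun k => ?_
    have := ae_lt_top (measurable_powTail d c (fun j => u j i) s)
      (lintegral_powTail_ne_top hd hdp hc (fun j => hu j i) s)
    filter_upwards [((hT i).iterate k).quasiMeasurePreserving.ae this] with x hx using hx.ne
  filter_upwards [hA, hB, hAB, hG, hfin,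
    ae_forall_exists_sum_condExp_powTail_lt hd hdp hc hu T] with x eA eB eAB eG efin esmall
  refine tendsto_of_hasSum_of_small_tails eA eB (fun j => ?_) fun ε hε => ?_
  · exact (tendsto_finsetProd _ fun i _ => (eAB j i).comp (tendsto_eval_pi _ i)).const_mul _
  -- Here `s` depends on the point `x`. The limit of the dominating averages is strictly below `ε`,
  -- so they are below `ε` for all large `n`.
  · obtain ⟨s, hs⟩ := esmall ε hε
    have h1 : Tendsto (fun n : Fin d → ℕ => ∑ i, birkhoffAverage ℝ (T i)
        (fun y => (powTail d c (fun j => u j i) s y).toReal) (n i) x) (Filter.pi fun _ => atTop)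
        (𝓝 (∑ i, (μ[fun y => (powTail d c (fun j => u j i) s y).toReal |
          MeasurableSpace.invariants (T i)]) x)) :=
      tendsto_finsetSum _ fun i _ => (eG s i).comp (tendsto_eval_pi _ i)
    refine ⟨s, ?_⟩
    filter_upwards [h1.eventually (gt_mem_nhds hs)] with n hn t ht
    exact (norm_sum_smul_prod_birkhoffAverage_le hd ht (efin s) n).trans hn.le

end Pointwise

end VStat

end

theorem proposition3 {𝕜 : Type*} [RCLike 𝕜] {X : Type*} [MeasurableSpace X]
    (μ : Measure X) [IsProbabilityMeasure μ] (d : ℕ) (p r : ℝ≥0∞)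
    [Fact (1 ≤ p)] [Fact (1 ≤ r)] (hr : r ≠ ∞) (hpr : p = r * d)
    (T : Fin d → X → X) (hT : ∀ i, MeasurePreserving (T i) μ μ) (f : VStat.LpPi 𝕜 d p μ) :
    (∀ᵐ x ∂μ, Tendsto (fun n : Fin d → ℕ => (VStat.ergodicAverage hr hpr hT f n : X → 𝕜) x)
      (Filter.pi fun _ => atTop)
      (𝓝 ((VStat.diag μ hr hpr
        (VStat.LpPi.map (fun i => VStat.condExpInv 𝕜 μ p (T i)) f) : X → 𝕜) x))) ∧
    Tendsto (fun n : Fin d → ℕ => VStat.ergodicAverage hr hpr hT f n)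
      (Filter.pi fun _ => atTop)
      (𝓝 (VStat.diag μ hr hpr
        (VStat.LpPi.map (fun i => VStat.condExpInv 𝕜 μ p (T i)) f))) :=
  ⟨VStat.ae_tendsto_ergodicAverage hr hpr hT f, VStat.tendsto_ergodicAverage hr hpr hT f⟩
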